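/- Let $G$ be a finite group of order $n$, written additively, and $G^*=G\setminus\{0\}$. For $D\subseteq G$ let $\Delta(D)$ be the multiset $\{x-y: x\neq y\in D\}$, and for disjoint $D_1,D_2\subseteq G$ let $\Delta(D_1,D_2)$ be the multiset $\{x-y: x\in D_1,\,y\in D_2\}$; for non-negative integers $\lambda,\mu$ and $S\subseteq G$ let $\lambda S+\mu(G^*\setminus S)$ be the multiset containing each element of $S$ exactly $\lambda$ times and each element of $G^*\setminus S$ exactly $\mu$ times. A $k$-subset $P\subseteq G$ is an $(n,k,\lambda,\mu)$-PDS if $\Delta(P)=\lambda P+\mu(G^*\setminus P)$; it is proper if $\lambda\neq\mu$, and regular if $P=-P$ and $0\notin P$. A collection $\{D_1,\dots,D_m\}$ of $m$ pairwise disjoint $k$-subsets of $G^*$ with union $S$ is an $(n,m,k,\lambda,\mu)$-DPDF if $\bigcup_i\Delta(D_i)=\lambda S+\mu(G^*\setminus S)$, and an $(n,m,k,\lambda,\mu)$-EPDF if $\bigcup_{i\neq j}\Delta(D_i,D_j)=\lambda S+\mu(G^*\setminus S)$ (unions of multisets, adding multiplicities). Theorem. Let $q$ be a prime power, $\beta\ge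 1$ an integer and $q'=q^{2\beta}$. Let $\alpha$ be a primitive element of $\mathrm{GF}(q')$, let $e\ge 3$ be an integer dividing $q+1$, put $\eta=\frac{(-q)^{\beta}-1}{e}$, and let $C_i^e=\alpha^i\langle\alpha^e\rangle$ for $0\le i\le e-1$. In the additive group of $\mathrm{GF}(q')$ the following hold. (i) Each $C_i^e$ is a regular $\left(q',\frac{q'-1}{e},\eta^2-(e-3)\eta-1,\eta^2+\eta\right)$-PDS. Moreover, for every $I\subseteq\{0,1,\dots,e-1\}$ with $|I|=u$ and $2\le u\le e-1$: (ii) $\{C_i^e\}_{i\in I}$ is a $\left(q',u,\frac{q'-1}{e},u\eta^2+(u+2-e)\eta-1,u(\eta^2+\eta)\right)$-DPDF and a $\left(q',u,\frac{q'-1}{e},u(u-1)\eta^2+2(u-1)\eta,u(u-1)\eta^2\right)$-EPDF. (iii) $\bigcup_{i\in I}C_i^e$ is a regular $\left(q',\frac{u(q'-1)}{e},u^2\eta^2+(3u-e)\eta-1,u^2\eta^2+u\eta\right)$-PDS, and it is proper except precisely when $\eta=1=2u-e$ or $\eta=-1=2u-e$. -/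

import Mathlib

/-- The multiset `Δ(D) = {x - y : x ≠ y ∈ D}` of internal differences. -/
def internalDiff {G : Type*} [AddGroup G] [DecidableEq G] (D : Finset G) : Multiset G :=
  D.offDiag.val.map fun p => p.1 - p.2

/-- The multiset `Δ(D₁, D₂) = {x - y : x ∈ D₁, y ∈ D₂}` of external differences. -/
def externalDiff {G : Type*} [AddGroup G] (D₁ D₂ : Finset G) : Multiset G :=
  (D₁ ×ˢ D₂).val.map fun p => p.1 - p.2

/-- The multiset `lam S + mu (G* \ S)`, where `G* = G \ {0}`. -/
def twoLevel {G : Type*} [AddGroup G] [Fintype G] [DecidableEq G]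
    (S : Finset G) (lam mu : ℕ) : Multiset G :=
  lam • S.val + mu • ((Finset.univ \ {0}) \ S).val

/-- `P` is an `(n, k, lam, mu)`-partial difference set of `G`. -/
structure IsPDS {G : Type*} [AddGroup G] [Fintype G] [DecidableEq G]
    (P : Finset G) (n k lam mu : ℕ) : Prop where
  card_group : Fintype.card G = n
  card_set : P.card = k
  diff_eq : internalDiff P = twoLevel P lam mu

/-- A proper partial difference set: the two frequencies differ. -/
structure IsProperPDS {G : Type*} [AddGroup G] [Fintype G] [DecidableEq G]
    (P : Finset G) (n k lam mu : ℕ) : Prop extends IsPDS P n k lam mu where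
  proper : lam ≠ mu

/-- A regular partial difference set: `-P = P` and `0 ∉ P`. -/
structure IsRegularPDS {G : Type*} [AddGroup G] [Fintype G] [DecidableEq G]
    (P : Finset G) (n k lam mu : ℕ) : Prop extends IsPDS P n k lam mu where
  neg_eq : P.image (fun x => -x) = P
  zero_notMem : (0 : G) ∉ P

/-- `𝒮` is a collection of `m` pairwise disjoint `k`-subsets of `G* = G \ {0}`,
where `G` has order `n`. -/
structure IsDisjointFamily {G : Type*} [AddGroup G] [Fintype G] [DecidableEq G]
    (𝒮 : Finset (Finset G)) (n m k : ℕ) : Prop where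
  card_group : Fintype.card G = n
  card_family : 𝒮.card = m
  card_set : ∀ D ∈ 𝒮, D.card = k
  zero_notMem : ∀ D ∈ 𝒮, (0 : G) ∉ D
  disjoint : ∀ D ∈ 𝒮, ∀ D' ∈ 𝒮, D ≠ D' → Disjoint D D'

/-- `𝒮` is an `(n, m, k, lam, mu)`-disjoint partial difference family of `G`. -/
structure IsDPDF {G : Type*} [AddGroup G] [Fintype G] [DecidableEq G]
    (𝒮 : Finset (Finset G)) (n m k lam mu : ℕ) : Prop
    extends IsDisjointFamily 𝒮 n m k where
  diff_eq : ∑ D ∈ 𝒮, internalDiff D = twoLevel (𝒮.biUnion id) lam mu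

/-- `𝒮` is an `(n, m, k, lam, mu)`-external partial difference family of `G`. -/
structure IsEPDF {G : Type*} [AddGroup G] [Fintype G] [DecidableEq G]
    (𝒮 : Finset (Finset G)) (n m k lam mu : ℕ) : Prop
    extends IsDisjointFamily 𝒮 n m k where
  diff_eq : ∑ p ∈ 𝒮.offDiag, externalDiff p.1 p.2 = twoLevel (𝒮.biUnion id) lam mu

open Classical in
/-- The cyclotomic class `C_i^e = α^i ⟨α^e⟩` with respect to the unit `α`. -/
noncomputable def cyclotomicClass {F : Type*} [Field F] [Fintype F] (α : Fˣ) (e i : ℕ) :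
    Finset F :=
  Finset.univ.filter fun x => ∃ y ∈ Subgroup.zpowers (α ^ e), x = ((α ^ i * y : Fˣ) : F)

/-! Fourier analysis on the additive group of $F$, $|F| = q^{2\beta}$: difference counts of
cyclotomic classes are computed from their character sums (Gauss periods). Put $T = (-q)^\beta = 1 +
e\eta$.

For the group $H$ of $(q+1)$-th powers, a period is read off from $S(a) = \sum_x \psi(a x^{q+1})$.
If $\psi$ is Frobenius invariant, the exponent behaves like a Hermitian form, and $S(a)S(-a) = |F|$
unless its radical $\{z : az + a^q z^{q^2} = 0\}$ is nonzero (`hermitianSum_mul_neg`). Since $-1 \in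
H$, $S(a) = \pm q^\beta$; since $S(a) \equiv 1$ modulo $q+1$ in the algebraic integers, $S(a) = T$.
A degenerate $a$ lies in one particular coset of $H$, whose period is forced by the sum of all
periods. Summing over cosets gives, for $K = \langle\alpha^e\rangle$, period $\eta$ off one coset
and $\eta - T$ on it (`exists_gaussPeriod_eq`).

Two-valued periods make the product of two class transforms an affine combination of the transforms
of the classes, of a point mass at $0$ and of a constant. Fourier inversion turns this into the
count of $d \ne 0$ in $\Delta(C_i, C_j)$ (`diffCount_unitCoset`). Diagonal pairs then give the DPDF,
all pairs the PDS, and their difference the EPDF. -/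

section SemiprimitiveCyclotomy

open Finset

/-! ### Characteristic and Frobenius-invariant characters -/

/-- A prime power `q` some power of which is the order of the field `F` is a power of the
characteristic of `F`. -/
theorem exists_charP_of_card_eq_pow {F : Type*} [Field F] [Fintype F] {q m : ℕ}
    (hq : IsPrimePow q) (hF : Fintype.card F = q ^ m) :
    ∃ p n : ℕ, p.Prime ∧ CharP F p ∧ q = p ^ n := by
  obtain ⟨p, n, hp, hn, rfl⟩ := (isPrimePow_nat_iff _).1 hq
  refine ⟨p, n, hp, ?_, rfl⟩
  obtain ⟨r, hr⟩ := CharP.exists F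
  have hrp : r.Prime := CharP.char_is_prime F r
  have : Fact r.Prime := ⟨hrp⟩
  obtain ⟨s, -, hs⟩ := FiniteField.card F r
  have hdvd : r ∣ p := by
    apply hrp.dvd_of_dvd_pow (n := n * m)
    rw [pow_mul, ← hF, hs]
    exact dvd_pow_self _ s.ne_zero
  rwa [← (Nat.prime_dvd_prime_iff_eq hrp hp).1 hdvd]

/-- A finite field of characteristic `p` has a primitive complex additive character that is
invariant under the Frobenius automorphism. -/
theorem exists_isPrimitive_frobenius_invariant (F : Type*) [Field F] [Fintype F] (p : ℕ)
    (hp : p.Prime) [CharP F p] :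
    ∃ ψ : AddChar F ℂ, ψ.IsPrimitive ∧ ∀ x, ψ (x ^ p) = ψ x := by
  have : Fact p.Prime := ⟨hp⟩
  let _ : Algebra (ZMod p) F := ZMod.algebra F p
  let ψ : AddChar F ℂ :=
    (ZMod.stdAddChar (N := p)).compAddMonoidHom (Algebra.trace (ZMod p) F).toAddMonoidHom
  have hψ : ∀ x, ψ x = ZMod.stdAddChar (Algebra.trace (ZMod p) F x) := fun _ => rfl
  -- Over a field nontrivial means primitive. Nontriviality comes from surjectivity of the trace,
  -- invariance from its invariance under automorphisms.
  refine ⟨ψ, AddChar.IsPrimitive.of_ne_one ?_, fun x => ?_⟩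
  · intro h
    obtain ⟨x, hx⟩ := Algebra.trace_surjective (ZMod p) F 1
    have h1 : ψ x = 1 := by rw [h]; rfl
    rw [hψ, hx] at h1
    have := ZMod.injective_stdAddChar (h1.trans (AddChar.map_zero_eq_one _).symm)
    exact one_ne_zero this
  · rw [hψ, hψ]
    have := Algebra.trace_eq_of_algEquiv
      (FiniteField.frobeniusAlgEquivOfAlgebraic (ZMod p) F) x
    rw [FiniteField.coe_frobeniusAlgEquivOfAlgebraic, ZMod.card] at this
    rw [this]

/-! ### Hermitian-type exponential sums -/

section

variable {F : Type*} [Field F] {p n q : ℕ}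

theorem addChar_pow_eq {ψ : AddChar F ℂ} (hψ : ∀ x, ψ (x ^ p) = ψ x) (x : F) :
    ψ (x ^ p ^ n) = ψ x := by
  induction n with
  | zero => simp
  | succ n ih => rw [pow_succ, pow_mul, hψ, ih]

/-- The Hermitian-type exponential sum `∑ x, ψ (a x ^ (q + 1))` has square `|F|` as soon as the
additive polynomial `a z + a ^ q z ^ (q ^ 2)` has no nonzero root. -/
theorem hermitianSum_mul_neg [Fintype F] [DecidableEq F] (hp : p.Prime) [CharP F p] (hq : q = p ^ n) {ψ : AddChar F ℂ}
    (hprim : ψ.IsPrimitive) (hψ : ∀ x, ψ (x ^ p) = ψ x) (a : F)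
    (ha : ∀ z : F, a * z + a ^ q * (z ^ q) ^ q = 0 → z = 0) :
    (∑ x, ψ (a * x ^ (q + 1))) * (∑ x, ψ (-a * x ^ (q + 1))) = Fintype.card F := by
  have : Fact p.Prime := ⟨hp⟩
  have hψq : ∀ x, ψ (x ^ q) = ψ x := fun x => by rw [hq]; exact addChar_pow_eq hψ x
  have hadd : ∀ x y : F, (x + y) ^ q = x ^ q + y ^ q := fun x y => by
    rw [hq, add_pow_char_pow]
  have hbij : Function.Bijective fun x : F => x ^ q := by
    rw [hq]
    exact (Finite.injective_iff_bijective).1 (iterateFrobenius_inj F p n)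
  have inner : ∀ z : F, ∑ y, ψ (a * (y + z) ^ (q + 1) + -a * y ^ (q + 1)) =
      ψ (a * z ^ (q + 1)) * if a * z + a ^ q * (z ^ q) ^ q = 0 then (Fintype.card F : ℂ) else 0 := by
    intro z
    have h1 := AddChar.sum_mulShift (a * z + a ^ q * (z ^ q) ^ q) hprim
    push_cast at h1
    rw [← h1, ← hbij.sum_comp fun x => ψ (x * (a * z + a ^ q * (z ^ q) ^ q)), mul_sum]
    refine sum_congr rfl fun y _ => ?_
    have h2 : a * (y + z) ^ (q + 1) + -a * y ^ (q + 1) =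
        a * z ^ (q + 1) + (y ^ q * (a * z) + a * y * z ^ q) := by
      rw [pow_succ, hadd]; ring
    -- Frobenius invariance replaces $a y z^q$ by its $q$-th power, so that both cross terms become
    -- multiples of $y^q$, which runs over all of $F$.
    rw [h2, AddChar.map_add_eq_mul, AddChar.map_add_eq_mul, ← hψq (a * y * z ^ q),
      ← AddChar.map_add_eq_mul]
    congr 2
    ring
  calc _ = ∑ y, ∑ x, ψ (a * x ^ (q + 1) + -a * y ^ (q + 1)) := by
        rw [sum_mul_sum, sum_comm]
        simp_rw [AddChar.map_add_eq_mul]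
    _ = ∑ y, ∑ z, ψ (a * (y + z) ^ (q + 1) + -a * y ^ (q + 1)) := by
        refine sum_congr rfl fun y _ => ?_
        exact (Equiv.sum_comp (Equiv.addLeft y) fun x => ψ (a * x ^ (q + 1) + -a * y ^ (q + 1))).symm
    _ = ∑ z, ψ (a * z ^ (q + 1)) *
          if a * z + a ^ q * (z ^ q) ^ q = 0 then (Fintype.card F : ℂ) else 0 := by
        rw [sum_comm]
        exact sum_congr rfl fun z _ => inner z
    _ = _ := by
        rw [sum_eq_single 0]
        · have : q ≠ 0 := by rw [hq]; exact pow_ne_zero _ hp.ne_zero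
          simp [this]
        · intro z _ hz
          rw [if_neg fun h => hz (ha z h), mul_zero]
        · simp

end

/-! ### Sums over subgroups and fibres -/

section GroupSums

variable {G : Type*} [CommGroup G] [Fintype G]

open Classical in
theorem Subgroup.sum_ite_mem_one (H : Subgroup G) :
    ∑ h : G, (if h ∈ H then (1 : ℂ) else 0) = Nat.card H := by
  rw [sum_boole, Nat.card_eq_fintype_card, Fintype.card_subtype]

open Classical in
theorem MonoidHom.sum_comp_eq_card_ker_mul (φ : G →* G) {H : Subgroup G} (hH : H = φ.range)
    (f : G → ℂ) : ∑ y, f (φ y) = Nat.card φ.ker * ∑ h, if h ∈ H then f h else 0 := by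
  subst hH
  rw [← sum_fiberwise (s := univ) (g := φ), mul_sum]
  refine sum_congr rfl fun h _ => ?_
  have h1 : ∑ y ∈ univ.filter (fun y => φ y = h), f (φ y) =
      (univ.filter fun y => φ y = h).card * f h := by
    rw [sum_congr rfl fun y hy => by rw [(mem_filter.1 hy).2], sum_const, nsmul_eq_mul]
  rw [h1]
  split_ifs with hh
  · have := MonoidHom.card_fiber_eq_of_mem_range φ hh ⟨1, map_one φ⟩
    rw [this, Nat.card_eq_fintype_card, Fintype.card_subtype]
    simp only [MonoidHom.mem_ker]
  · rw [filter_false_of_mem, card_empty]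
    · simp
    · intro y _ hy
      exact hh ⟨y, hy⟩

end GroupSums

/-! ### Gauss periods in the semiprimitive case -/

section GaussPeriod

variable {F : Type*} [Field F] [Fintype F] [DecidableEq F]

open Classical in
/-- The sum of the additive character `ψ` over the coset `b H` of a group of units `H`. -/
noncomputable def gaussPeriod (ψ : AddChar F ℂ) (H : Subgroup Fˣ) (b : F) : ℂ :=
  ∑ h : Fˣ, if h ∈ H then ψ (b * h) else 0

theorem gaussPeriod_mul_mem (ψ : AddChar F ℂ) (H : Subgroup Fˣ) (b : F) {t : Fˣ} (ht : t ∈ H) :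
    gaussPeriod ψ H (b * t) = gaussPeriod ψ H b := by
  classical
  unfold gaussPeriod
  rw [← Equiv.sum_comp (Equiv.mulLeft t) fun h : Fˣ => if h ∈ H then ψ (b * h) else 0]
  refine sum_congr rfl fun h _ => ?_
  simp [H.mul_mem_cancel_left ht, mul_assoc]

/-- Values of $\psi$ are roots of unity. Integrality is what later fixes the sign of the Hermitian
sum. -/
theorem gaussPeriod_isIntegral (ψ : AddChar F ℂ) (H : Subgroup Fˣ) (b : F) :
    IsIntegral ℤ (gaussPeriod ψ H b) := by
  refine IsIntegral.sum _ fun h _ => ?_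
  split_ifs
  · refine IsIntegral.of_pow (Fintype.card_pos (α := F)) ?_
    rw [← AddChar.map_nsmul_eq_pow, card_nsmul_eq_zero, AddChar.map_zero_eq_one]
    exact isIntegral_one
  · exact isIntegral_zero

theorem sum_units_eq_sum_sub (f : F → ℂ) : ∑ y : Fˣ, f y = ∑ x, f x - f 0 := by
  rw [eq_sub_iff_add_eq, ← Finset.sum_erase_add _ _ (mem_univ (0 : F))]
  congr 1
  refine sum_bij (fun y _ => (y : F)) (fun y _ => by simp) (fun _ _ _ _ h => Units.ext h)
    (fun x hx => ⟨Units.mk0 x (by simpa using hx), mem_univ _, rfl⟩) fun _ _ => rfl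

/-- Each $h \in H$ contributes the sum of a nontrivial character over $F^*$, which is $-1$. -/
theorem sum_units_gaussPeriod {ψ : AddChar F ℂ} (hprim : ψ.IsPrimitive) (H : Subgroup Fˣ) :
    ∑ b : Fˣ, gaussPeriod ψ H b = -Nat.card H := by
  classical
  unfold gaussPeriod
  rw [sum_comm, ← H.sum_ite_mem_one, ← sum_neg_distrib]
  refine sum_congr rfl fun h _ => ?_
  split_ifs
  · have := AddChar.sum_mulShift (h : F) hprim
    rw [sum_units_eq_sum_sub fun b => ψ (b * h), this]
    simp
  · simp

/-- The unit group is cyclic of order divisible by $m$, so every $m$-th power is hit $m$ times; $x =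
0$ contributes the $1$. -/
theorem hermitianSum_eq_gaussPeriod (ψ : AddChar F ℂ) {m : ℕ} (hm : m ≠ 0)
    (hdvd : m ∣ Fintype.card F - 1) {H : Subgroup Fˣ}
    (hH : H = (powMonoidHom m : Fˣ →* Fˣ).range) (b : F) :
    ∑ x, ψ (b * x ^ m) = 1 + m * gaussPeriod ψ H b := by
  classical
  have h1 := MonoidHom.sum_comp_eq_card_ker_mul (powMonoidHom m : Fˣ →* Fˣ) hH
    fun h => ψ (b * h)
  rw [IsCyclic.card_powMonoidHom_ker, Nat.card_eq_fintype_card, Fintype.card_units,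
    Nat.gcd_eq_right hdvd] at h1
  have h2 := sum_units_eq_sum_sub fun x : F => ψ (b * x ^ m)
  simp only [powMonoidHom_apply, Units.val_pow_eq_pow_val] at h1
  rw [h1] at h2
  simp only [ne_eq, hm, not_false_eq_true, zero_pow, mul_zero, AddChar.map_zero_eq_one] at h2
  unfold gaussPeriod
  rw [h2]
  ring

theorem succ_mul_pred_dvd_pow_sub_one (q β : ℕ) : (q + 1) * (q - 1) ∣ q ^ (2 * β) - 1 := by
  rw [← Nat.sq_sub_sq q 1, pow_mul]
  simpa using Nat.sub_dvd_pow_sub_pow (q ^ 2) 1 β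

/-- The nonzero elements fixed by `x ↦ x ^ q` are `(q + 1)`-th powers. -/
theorem mem_range_powMonoidHom_of_pow_eq {q β : ℕ} (hq : 2 ≤ q)
    (hF : Fintype.card F = q ^ (2 * β)) {t : Fˣ} (ht : t ^ q = t) :
    t ∈ (powMonoidHom (q + 1) : Fˣ →* Fˣ).range := by
  obtain ⟨g, hg⟩ := IsCyclic.exists_generator (α := Fˣ)
  obtain ⟨s, rfl⟩ := mem_powers_iff_mem_zpowers.2 (hg t)
  have h1 : g ^ (s * (q - 1)) = 1 := by
    obtain ⟨r, rfl⟩ : ∃ r, q = r + 1 := ⟨q - 1, by omega⟩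
    simp only at ht
    rw [pow_succ (g ^ s), mul_eq_right] at ht
    rw [Nat.add_sub_cancel, pow_mul, ht]
  rw [← orderOf_dvd_iff_pow_eq_one, orderOf_eq_card_of_forall_mem_zpowers hg,
    Nat.card_eq_fintype_card, Fintype.card_units, hF] at h1
  -- Both $(q+1)(q-1) \mid |F^*|$ and $|F^*| \mid s(q-1)$ hold; cancelling $q-1$ leaves $q+1 \mid
  -- s$.
  obtain ⟨r, hr⟩ := Nat.dvd_of_mul_dvd_mul_right (by omega)
    ((succ_mul_pred_dvd_pow_sub_one q β).trans h1)
  exact ⟨g ^ r, by simp only [powMonoidHom_apply]; rw [hr, ← pow_mul, mul_comm]⟩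

/-- Additivity of Frobenius covers odd and even characteristic at once. -/
theorem neg_pow_charP_pow {R : Type*} [CommRing R] {p : ℕ} (hp : p.Prime) [CharP R p] (n : ℕ)
    (x : R) : (-x) ^ p ^ n = -x ^ p ^ n := by
  have : Fact p.Prime := ⟨hp⟩
  have h := add_pow_char_pow x (-x) p (n := n)
  rw [add_neg_cancel, zero_pow (pow_ne_zero _ hp.ne_zero)] at h
  exact (neg_eq_of_add_eq_zero_right h.symm).symm

/-- An integer `S = ± q ^ β` with `S ≡ 1` modulo `q + 1 ≥ 3` is `(-q) ^ β`. -/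
theorem eq_neg_pow_of_sq_eq {q β : ℕ} (hq : 2 ≤ q) {S P : ℂ} (hS : S ^ 2 = (q : ℂ) ^ (2 * β))
    (hP : IsIntegral ℤ P) (hSP : S = 1 + (q + 1) * P) : S = (-(q : ℂ)) ^ β := by
  have h1 : S ^ 2 = ((-(q : ℂ)) ^ β) ^ 2 := by
    rw [hS, ← pow_mul, mul_comm β 2, pow_mul, pow_mul, neg_sq]
  rcases sq_eq_sq_iff_eq_or_eq_neg.1 h1 with h | h
  · exact h
  exfalso
  have hq0 : ((q : ℂ) + 1) ≠ 0 := by exact_mod_cast Nat.succ_ne_zero q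
  have hq1 : ((q : ℚ) + 1) ≠ 0 := by positivity
  -- With the wrong sign $P$ is rational, hence an integer, so $q+1$ divides $-(-q)^\beta - 1$. It
  -- also divides $(-q)^\beta - 1$, hence $2$, against $q + 1 \ge 3$.
  have h2 : P = algebraMap ℚ ℂ ((-(-(q : ℚ)) ^ β - 1) / (q + 1)) := by
    simp only [eq_ratCast]
    push_cast
    field_simp
    rw [h] at hSP
    linear_combination -hSP
  rw [h2, isIntegral_algebraMap_iff (algebraMap ℚ ℂ).injective] at hP
  obtain ⟨m, hm⟩ := IsIntegrallyClosed.isIntegral_iff.1 hP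
  rw [eq_div_iff hq1] at hm
  have h3 : m * ((q : ℤ) + 1) = -(-(q : ℤ)) ^ β - 1 := by
    simp only [eq_intCast] at hm
    exact_mod_cast hm
  have h4 : (q : ℤ) + 1 ∣ (-(q : ℤ)) ^ β - 1 := by
    have := sub_dvd_pow_sub_pow (-(q : ℤ)) 1 β
    rw [one_pow] at this
    exact (by ring : -((q : ℤ) + 1) = -q - 1) ▸ this |> neg_dvd.1
  have h5 : (q : ℤ) + 1 ∣ 2 := by
    have h6 : (q : ℤ) + 1 ∣ -(-(q : ℤ)) ^ β - 1 := ⟨m, by rw [← h3]; ring⟩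
    have := dvd_add h4 h6
    rw [← dvd_neg]
    convert this using 1
    ring
  have := Int.le_of_dvd (by norm_num) h5
  omega

/-- The period of the group of `(q + 1)`-th powers, away from a single coset. -/
theorem gaussPeriod_eq_of_forall_ne {p n q β : ℕ} (hp : p.Prime) [CharP F p] (hpq : q = p ^ n)
    (hq : 2 ≤ q) (hF : Fintype.card F = q ^ (2 * β)) {ψ : AddChar F ℂ} (hprim : ψ.IsPrimitive)
    (hψ : ∀ x, ψ (x ^ p) = ψ x) {H : Subgroup Fˣ}
    (hH : H = (powMonoidHom (q + 1) : Fˣ →* Fˣ).range) (a : Fˣ)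
    (ha : ∀ w : Fˣ, (w : F) ^ q = -w → w⁻¹ * a ∉ H) :
    gaussPeriod ψ H a = ((-(q : ℂ)) ^ β - 1) / (q + 1) := by
  have hdvd : q + 1 ∣ Fintype.card F - 1 := by
    rw [hF]; exact (Dvd.intro _ rfl).trans (succ_mul_pred_dvd_pow_sub_one q β)
  have hsum := hermitianSum_mul_neg hp hpq hprim hψ (a : F) fun z hz => by
    by_contra hz0
    -- A nonzero root $z$ yields $w = a z^{q+1}$ with $w^q = -w$ and $w^{-1}a = z^{-(q+1)} \in H$.
    refine ha (a * Units.mk0 z hz0 ^ (q + 1)) ?_ (hH ▸ ⟨(Units.mk0 z hz0)⁻¹, ?_⟩)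
    · simp only [Units.val_mul, Units.val_pow_eq_pow_val, Units.val_mk0]
      linear_combination z ^ q * hz
    · simp [inv_pow]
  have hneg : (-1 : Fˣ) ∈ H := by
    refine hH ▸ mem_range_powMonoidHom_of_pow_eq hq hF (Units.ext ?_)
    push_cast
    rw [hpq, neg_pow_charP_pow hp, one_pow]
  have h1 := hermitianSum_eq_gaussPeriod ψ (Nat.succ_ne_zero q) hdvd hH (a : F)
  have h2 := hermitianSum_eq_gaussPeriod ψ (Nat.succ_ne_zero q) hdvd hH (-(a : F))
  have h3 := gaussPeriod_mul_mem ψ H (a : F) hneg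
  rw [show (a : F) * ((-1 : Fˣ) : F) = -a by simp] at h3
  rw [h3, ← h1] at h2
  rw [h2, ← sq, hF] at hsum
  push_cast at hsum h1
  have h4 := eq_neg_pow_of_sq_eq hq hsum (gaussPeriod_isIntegral _ _ _) h1
  have hq0 : ((q : ℂ) + 1) ≠ 0 := by exact_mod_cast Nat.succ_ne_zero q
  rw [eq_div_iff hq0, ← h4, h1]
  ring

open Classical in
/-- The periods of the group of `(q + 1)`-th powers take two values, one of them on exactly one
coset. -/
theorem exists_gaussPeriod_range_eq {p n q β : ℕ} (hp : p.Prime) [CharP F p] (hpq : q = p ^ n)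
    (hq : 2 ≤ q) (hF : Fintype.card F = q ^ (2 * β)) {ψ : AddChar F ℂ} (hprim : ψ.IsPrimitive)
    (hψ : ∀ x, ψ (x ^ p) = ψ x) {H : Subgroup Fˣ}
    (hH : H = (powMonoidHom (q + 1) : Fˣ →* Fˣ).range) :
    ∃ c : Fˣ, ∀ b : Fˣ, gaussPeriod ψ H b =
      ((-(q : ℂ)) ^ β - 1) / (q + 1) - if c⁻¹ * b ∈ H then (-(q : ℂ)) ^ β else 0 := by
  set T := (-(q : ℂ)) ^ β with hT
  have hT0 : T ≠ 0 := pow_ne_zero _ (neg_ne_zero.2 (by exact_mod_cast (by omega : q ≠ 0)))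
  have hq0 : ((q : ℂ) + 1) ≠ 0 := by exact_mod_cast Nat.succ_ne_zero q
  have hdvd : q + 1 ∣ Fintype.card F - 1 := by
    rw [hF]; exact (Dvd.intro _ rfl).trans (succ_mul_pred_dvd_pow_sub_one q β)
  have hcard : (Fintype.card Fˣ : ℂ) = (q + 1) * Nat.card H := by
    have h1 : H.index = q + 1 := by
      rw [hH, IsCyclic.index_powMonoidHom_range, Nat.card_eq_fintype_card, Fintype.card_units,
        Nat.gcd_eq_right hdvd]
    have h2 := H.card_mul_index
    rw [h1, Nat.card_eq_fintype_card (α := Fˣ)] at h2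
    rw [← h2]
    push_cast
    ring
  have hHpos : (Nat.card H : ℂ) ≠ 0 := by exact_mod_cast Nat.card_pos.ne'
  have hsum := sum_units_gaussPeriod hprim H
  have hgen := gaussPeriod_eq_of_forall_ne hp hpq hq hF hprim hψ hH
  rw [← hT] at hgen
  -- Without such a $w$ all periods would equal $(T-1)/(q+1)$ and add up to $|H|(T-1)$ instead of
  -- $-|H|$.
  obtain ⟨w, hw⟩ : ∃ w : Fˣ, (w : F) ^ q = -w := by
    by_contra! hne
    rw [sum_congr rfl fun b _ => hgen b fun w hw => absurd hw (hne w), sum_const, card_univ,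
      nsmul_eq_mul, hcard] at hsum
    field_simp at hsum
    exact hT0 (by linear_combination hsum)
  -- Two solutions of $w^q = -w$ have a ratio fixed by $x \mapsto x^q$, hence in $H$: only the coset
  -- $wH$ is exceptional.
  have huniq : ∀ b : Fˣ, w⁻¹ * b ∉ H → gaussPeriod ψ H b = (T - 1) / (q + 1) := by
    refine fun b hb => hgen b fun w' hw' hmem => hb ?_
    have h1 : w⁻¹ * w' ∈ H := by
      refine hH ▸ mem_range_powMonoidHom_of_pow_eq hq hF (Units.ext ?_)
      push_cast
      rw [mul_pow, inv_pow, hw, hw', inv_neg, neg_mul_neg]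
    have := H.mul_mem h1 hmem
    rwa [mul_assoc, mul_inv_cancel_left] at this
  have hconst : ∀ b : Fˣ, w⁻¹ * b ∈ H → gaussPeriod ψ H b = gaussPeriod ψ H w := by
    intro b hb
    rw [← gaussPeriod_mul_mem ψ H (w : F) hb, ← Units.val_mul, mul_inv_cancel_left]
  have hval : ∀ b : Fˣ, gaussPeriod ψ H b = (T - 1) / (q + 1) -
      (if w⁻¹ * b ∈ H then 1 else 0) * ((T - 1) / (q + 1) - gaussPeriod ψ H w) := by
    intro b
    split_ifs with h
    · rw [hconst b h]; ring
    · rw [huniq b h]; ring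
  refine ⟨w, fun b => ?_⟩
  have hcoset : ∑ b : Fˣ, (if w⁻¹ * b ∈ H then (1 : ℂ) else 0) = Nat.card H := by
    rw [← H.sum_ite_mem_one]
    exact Equiv.sum_comp (Equiv.mulLeft w⁻¹) fun h => if h ∈ H then (1 : ℂ) else 0
  rw [sum_congr rfl fun b _ => hval b, sum_sub_distrib, ← sum_mul, hcoset, sum_const, card_univ,
    nsmul_eq_mul, hcard] at hsum
  -- The total $-|H|$ of all periods determines the remaining value on $wH$.
  have h5 : (T - 1) / (q + 1) - gaussPeriod ψ H w = T := by
    have h6 : (Nat.card H : ℂ) * ((T - 1) / (q + 1) - gaussPeriod ψ H w) = Nat.card H * T := by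
      have h7 : ((q : ℂ) + 1) * Nat.card H * ((T - 1) / (q + 1)) = Nat.card H * (T - 1) := by
        field_simp
      linear_combination h7 - hsum
    exact mul_left_cancel₀ hHpos h6
  rw [hval b, h5]
  split_ifs <;> ring

open Classical in
/-- The periods of a group of units containing the `(q + 1)`-th powers. -/
theorem exists_gaussPeriod_eq {p n q β e : ℕ} (hp : p.Prime) [CharP F p] (hpq : q = p ^ n)
    (hq : 2 ≤ q) (hF : Fintype.card F = q ^ (2 * β)) {ψ : AddChar F ℂ} (hprim : ψ.IsPrimitive)
    (hψ : ∀ x, ψ (x ^ p) = ψ x) (K : Subgroup Fˣ)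
    (hK : (powMonoidHom (q + 1) : Fˣ →* Fˣ).range ≤ K) (he : K.index = e) :
    ∃ c : Fˣ, ∀ b : Fˣ, gaussPeriod ψ K b =
      ((-(q : ℂ)) ^ β - 1) / e - if c⁻¹ * b ∈ K then (-(q : ℂ)) ^ β else 0 := by
  obtain ⟨H, hH⟩ : ∃ H, H = (powMonoidHom (q + 1) : Fˣ →* Fˣ).range := ⟨_, rfl⟩
  obtain ⟨c, hc⟩ := exists_gaussPeriod_range_eq hp hpq hq hF hprim hψ hH
  have hdvd : q + 1 ∣ Fintype.card F - 1 := by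
    rw [hF]; exact (Dvd.intro _ rfl).trans (succ_mul_pred_dvd_pow_sub_one q β)
  have hindex : H.index = q + 1 := by
    rw [hH, IsCyclic.index_powMonoidHom_range, Nat.card_eq_fintype_card, Fintype.card_units,
      Nat.gcd_eq_right hdvd]
  rw [← hH] at hK
  set T := (-(q : ℂ)) ^ β with hT
  have hq0 : ((q : ℂ) + 1) ≠ 0 := by exact_mod_cast Nat.succ_ne_zero q
  have he0 : (e : ℂ) ≠ 0 := by
    rw [← he]; exact_mod_cast Subgroup.index_ne_zero_of_finite
  have hHpos : (Nat.card H : ℂ) ≠ 0 := by exact_mod_cast Nat.card_pos.ne'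
  have hcards : (Nat.card K : ℂ) * e = Nat.card H * (q + 1) := by
    have h1 := H.card_mul_index
    rw [hindex, ← K.card_mul_index, he] at h1
    exact_mod_cast h1.symm
  refine ⟨c, fun b => ?_⟩
  -- Averaging over $H \le K$: the sum over $x \in K$ of the $H$-periods at $bx$ counts each element
  -- of $bK$ exactly $|H|$ times.
  have h1 : (Nat.card H : ℂ) * gaussPeriod ψ K b =
      ∑ x : Fˣ, if x ∈ K then gaussPeriod ψ H ((b * x : Fˣ) : F) else 0 := by
    have h2 : ∀ h : Fˣ, (if h ∈ H then (1 : ℂ) else 0) * gaussPeriod ψ K b =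
        ∑ x : Fˣ, if x ∈ K then (if h ∈ H then ψ ((b * x : Fˣ) * h) else 0) else 0 := by
      intro h
      split_ifs with hh
      · rw [one_mul, ← gaussPeriod_mul_mem ψ K b (hK hh)]
        unfold gaussPeriod
        refine sum_congr rfl fun x _ => ?_
        rw [Units.val_mul, mul_right_comm]
      · simp
    rw [← H.sum_ite_mem_one, sum_mul, sum_congr rfl fun h _ => h2 h, sum_comm]
    refine sum_congr rfl fun x _ => ?_
    unfold gaussPeriod
    split_ifs <;> simp
  -- The exceptional coset $cH$ is contained in $bK$ or disjoint from it.
  have h3 : ∑ x : Fˣ, (if x ∈ K then (if c⁻¹ * (b * x) ∈ H then (1 : ℂ) else 0) else 0) =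
      if c⁻¹ * b ∈ K then (Nat.card H : ℂ) else 0 := by
    split_ifs with hb
    · rw [← H.sum_ite_mem_one,
        ← Equiv.sum_comp (Equiv.mulLeft (c⁻¹ * b)) fun h : Fˣ => if h ∈ H then (1 : ℂ) else 0]
      refine sum_congr rfl fun x _ => ?_
      simp only [Equiv.coe_mulLeft, mul_assoc]
      by_cases hx : c⁻¹ * (b * x) ∈ H
      · have : x ∈ K := by
          have := hK hx
          rwa [← mul_assoc, K.mul_mem_cancel_left hb] at this
        simp [this]
      · simp [hx]
    · refine sum_eq_zero fun x _ => ?_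
      split_ifs with hx hx'
      · exact absurd (by simpa [← mul_assoc, K.mul_mem_cancel_right hx] using hK hx') hb
      · rfl
      · rfl
  have h4 : (Nat.card H : ℂ) * gaussPeriod ψ K b =
      Nat.card K * ((T - 1) / (q + 1)) -
        (if c⁻¹ * b ∈ K then (Nat.card H : ℂ) else 0) * T := by
    rw [h1, ← h3, ← K.sum_ite_mem_one, sum_mul, sum_mul, ← sum_sub_distrib]
    refine sum_congr rfl fun x _ => ?_
    rw [hc]
    split_ifs <;> ring
  have h5 : (Nat.card K : ℂ) * ((T - 1) / (q + 1)) = Nat.card H * ((T - 1) / e) := by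
    field_simp
    linear_combination (T - 1) * hcards
  apply mul_left_cancel₀ hHpos
  rw [h4, h5]
  split_ifs <;> ring

end GaussPeriod

/-! ### Difference counts by Fourier inversion -/

section DifferenceCount

/-- The number of pairs `(x, y) ∈ A × B` with `x - y = d`. -/
def diffCount {G : Type*} [AddGroup G] [DecidableEq G] (A B : Finset G) (d : G) : ℕ :=
  ∑ x ∈ A, ∑ y ∈ B, if x - y = d then 1 else 0

variable {F : Type*} [Field F] [Fintype F] [DecidableEq F]

theorem sum_diffCount_mul (ψ : AddChar F ℂ) (A B : Finset F) (b : F) :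
    ∑ d, (diffCount A B d : ℂ) * ψ (b * d) =
      (∑ x ∈ A, ψ (b * x)) * ∑ y ∈ B, ψ (-b * y) := by
  unfold diffCount
  push_cast
  simp_rw [sum_mul]
  rw [sum_comm]
  refine sum_congr rfl fun x _ => ?_
  rw [sum_comm, mul_sum]
  refine sum_congr rfl fun y _ => ?_
  rw [sum_eq_single (x - y)]
  · rw [if_pos rfl, one_mul, ← AddChar.map_add_eq_mul]
    congr 1
    ring
  · intro d _ hd
    rw [if_neg (Ne.symm hd), zero_mul]
  · simp

/-- Fourier inversion: primitivity makes $b \mapsto \psi(b\,\cdot)$ satisfy orthogonality, so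
$f(d)|F|$ is recovered from the transform. -/
theorem eq_of_sum_mul_addChar_eq {ψ : AddChar F ℂ} (hprim : ψ.IsPrimitive) {f g : F → ℂ}
    (h : ∀ b, ∑ x, f x * ψ (b * x) = ∑ x, g x * ψ (b * x)) : f = g := by
  have inv : ∀ (f : F → ℂ) (d : F),
      ∑ b, (∑ x, f x * ψ (b * x)) * ψ (b * -d) = f d * Fintype.card F := by
    intro f d
    simp_rw [sum_mul]
    rw [sum_comm]
    have h1 : ∀ x, ∑ b, f x * ψ (b * x) * ψ (b * -d) =
        f x * if x - d = 0 then (Fintype.card F : ℂ) else 0 := by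
      intro x
      have h2 := AddChar.sum_mulShift (x - d) hprim
      push_cast at h2
      rw [← h2, mul_sum]
      refine sum_congr rfl fun b _ => ?_
      rw [mul_assoc, ← AddChar.map_add_eq_mul]
      congr 2
      ring
    rw [sum_congr rfl fun x _ => h1 x, sum_eq_single d]
    · simp
    · intro x _ hx
      rw [if_neg (sub_ne_zero.2 hx), mul_zero]
    · simp
  funext d
  have hcard : (Fintype.card F : ℂ) ≠ 0 := by exact_mod_cast Fintype.card_ne_zero
  apply mul_right_cancel₀ hcard
  rw [← inv f d, ← inv g d]
  simp_rw [h]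

/-- The number of representations of `d ≠ 0` as a difference, read off the character sums. -/
theorem diffCount_eq_of_charSum {ψ : AddChar F ℂ} (hprim : ψ.IsPrimitive) {A B : Finset F}
    {r s t t' : ℂ}
    (h : ∀ b, (∑ x ∈ A, ψ (b * x)) * (∑ y ∈ B, ψ (-b * y)) =
      r + s * (if b = 0 then (Fintype.card F : ℂ) else 0) + t * (∑ x ∈ A, ψ (b * x)) +
        t' * ∑ x ∈ B, ψ (b * x)) {d : F} (hd : d ≠ 0) :
    (diffCount A B d : ℂ) = s + t * (if d ∈ A then 1 else 0) + t' * if d ∈ B then 1 else 0 := by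
  -- The term in $r$ is the transform of a point mass at $0$, the term in $s$ that of a constant;
  -- the former is invisible at $d \ne 0$.
  have key : (fun d => (diffCount A B d : ℂ)) = fun d => (if d = 0 then r else 0) + s +
      t * (if d ∈ A then 1 else 0) + t' * if d ∈ B then 1 else 0 := by
    refine eq_of_sum_mul_addChar_eq hprim fun b => ?_
    rw [sum_diffCount_mul, h]
    simp_rw [add_mul, sum_add_distrib]
    have h1 : ∑ x, (if x = 0 then r else 0) * ψ (b * x) = r := by
      rw [sum_eq_single 0] <;> simp +contextual
    have h2 : ∑ x, s * ψ (b * x) = s * if b = 0 then (Fintype.card F : ℂ) else 0 := by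
      have h3 := AddChar.sum_mulShift b hprim
      push_cast at h3
      rw [← h3, mul_sum]
      simp_rw [mul_comm b]
    have h4 : ∀ (v : ℂ) (D : Finset F), ∑ x, v * (if x ∈ D then 1 else 0) * ψ (b * x) =
        v * ∑ x ∈ D, ψ (b * x) := by
      intro v D
      rw [mul_sum, ← sum_subset (subset_univ D) fun x _ hx => by simp [hx]]
      exact sum_congr rfl fun x hx => by simp [hx]
    rw [h1, h2, h4, h4]
  have := congr_fun key d
  simpa [hd] using this

end DifferenceCount

/-! ### Cosets of a group of units -/

section Cosets

variable {F : Type*} [Field F] [Fintype F]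

open Classical in
/-- The coset `a K` of a group of units, as a set of field elements. -/
noncomputable def unitCoset (K : Subgroup Fˣ) (a : Fˣ) : Finset F :=
  univ.filter fun x => ∃ y ∈ K, x = ((a * y : Fˣ) : F)

theorem cyclotomicClass_eq_unitCoset (α : Fˣ) (e i : ℕ) :
    cyclotomicClass α e i = unitCoset (Subgroup.zpowers (α ^ e)) (α ^ i) := rfl

theorem mem_unitCoset {K : Subgroup Fˣ} {a : Fˣ} {x : F} :
    x ∈ unitCoset K a ↔ ∃ y ∈ K, x = ((a * y : Fˣ) : F) := by
  simp [unitCoset]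

theorem zero_notMem_unitCoset (K : Subgroup Fˣ) (a : Fˣ) : (0 : F) ∉ unitCoset K a := by
  rw [mem_unitCoset]
  rintro ⟨y, -, hy⟩
  exact (a * y).ne_zero hy.symm

theorem unitCoset_disjoint {K : Subgroup Fˣ} {a a' : Fˣ} (h : a⁻¹ * a' ∉ K) :
    Disjoint (unitCoset K a) (unitCoset K a') := by
  rw [Finset.disjoint_left]
  intro x hx hx'
  obtain ⟨y, hy, rfl⟩ := mem_unitCoset.1 hx
  obtain ⟨y', hy', h'⟩ := mem_unitCoset.1 hx'
  apply h
  have h1 : a * y = a' * y' := Units.ext h'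
  have h2 : a⁻¹ * a' = y * y'⁻¹ := by
    rw [inv_mul_eq_iff_eq_mul, ← mul_assoc, h1, mul_inv_cancel_right]
  rw [h2]
  exact K.mul_mem hy (K.inv_mem hy')

theorem image_neg_unitCoset [DecidableEq F] {K : Subgroup Fˣ} (hK : -1 ∈ K) (a : Fˣ) :
    (unitCoset K a).image (fun x => -x) = unitCoset K a := by
  have h1 : ∀ x ∈ unitCoset K a, -x ∈ unitCoset K a := by
    intro x hx
    obtain ⟨y, hy, rfl⟩ := mem_unitCoset.1 hx
    exact mem_unitCoset.2 ⟨-1 * y, K.mul_mem hK hy, by simp⟩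
  ext x
  rw [mem_image]
  refine ⟨?_, fun hx => ⟨-x, h1 x hx, neg_neg x⟩⟩
  rintro ⟨y, hy, rfl⟩
  exact h1 y hy

variable [DecidableEq F]

theorem sum_unitCoset (K : Subgroup Fˣ) (a : Fˣ) (f : F → ℂ) [DecidablePred (· ∈ K)] :
    ∑ x ∈ unitCoset K a, f x = ∑ y : Fˣ, if y ∈ K then f (a * y) else 0 := by
  rw [← sum_filter]
  symm
  refine sum_bij (fun y _ => ((a * y : Fˣ) : F)) ?_ ?_ ?_ ?_
  · intro y hy
    exact mem_unitCoset.2 ⟨y, (mem_filter.1 hy).2, rfl⟩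
  · intro y _ y' _ h
    exact mul_left_cancel (Units.ext h)
  · intro x hx
    obtain ⟨y, hy, rfl⟩ := mem_unitCoset.1 hx
    exact ⟨y, by simpa using hy, rfl⟩
  · intro y _
    rw [Units.val_mul]

theorem card_unitCoset (K : Subgroup Fˣ) (a : Fˣ) : (unitCoset K a).card = Nat.card K := by
  classical
  have h := sum_unitCoset K a fun _ => 1
  rw [K.sum_ite_mem_one, sum_const, nsmul_eq_mul, mul_one] at h
  exact_mod_cast h

theorem sum_addChar_unitCoset (ψ : AddChar F ℂ) (K : Subgroup Fˣ) (a : Fˣ) (b : F) :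
    ∑ x ∈ unitCoset K a, ψ (b * x) = gaussPeriod ψ K (b * a) := by
  classical
  rw [sum_unitCoset, gaussPeriod]
  simp_rw [mul_assoc]

open scoped Classical in
/-- Difference counts of two cosets of a group `K` of units all of whose periods but one
coincide. -/
theorem diffCount_unitCoset {ψ : AddChar F ℂ} (hprim : ψ.IsPrimitive) {K : Subgroup Fˣ}
    (hneg : -1 ∈ K) {c : Fˣ} {η T : ℂ} (hT : T ^ 2 = Fintype.card F)
    (hcard : (Nat.card K : ℂ) = η * (T + 1))
    (hper : ∀ b : Fˣ, gaussPeriod ψ K b = η - if c⁻¹ * b ∈ K then T else 0)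
    (a a' : Fˣ) {d : F} (hd : d ≠ 0) :
    (diffCount (unitCoset K a) (unitCoset K a') d : ℂ) = η ^ 2 +
      η * ((if d ∈ unitCoset K a then 1 else 0) + if d ∈ unitCoset K a' then 1 else 0) +
        if a⁻¹ * a' ∈ K then η - T * (if d ∈ unitCoset K a then 1 else 0) else 0 := by
  have hsum0 : ∀ a : Fˣ, ∑ x ∈ unitCoset K a, ψ (0 * x) = η * (T + 1) := by
    intro a
    simp only [zero_mul, AddChar.map_zero_eq_one, sum_const, nsmul_eq_mul, mul_one]
    rw [card_unitCoset, hcard]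
  have hsumneg : ∀ (a : Fˣ) (b : F),
      ∑ x ∈ unitCoset K a, ψ (-b * x) = ∑ x ∈ unitCoset K a, ψ (b * x) := by
    intro a b
    rw [sum_addChar_unitCoset, sum_addChar_unitCoset, ← gaussPeriod_mul_mem ψ K (b * a) hneg]
    simp
  have hsum : ∀ (a : Fˣ) (b : F) (hb : b ≠ 0), ∑ x ∈ unitCoset K a, ψ (b * x) =
      η - if c⁻¹ * (Units.mk0 b hb * a) ∈ K then T else 0 := by
    intro a b hb
    rw [sum_addChar_unitCoset, ← hper]
    simp
  by_cases haa : a⁻¹ * a' ∈ K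
  · have heq : unitCoset K a' = unitCoset K a := by
      ext x
      rw [mem_unitCoset, mem_unitCoset]
      constructor
      · rintro ⟨y, hy, rfl⟩
        exact ⟨a⁻¹ * a' * y, K.mul_mem haa hy, by simp [mul_assoc]⟩
      · rintro ⟨y, hy, rfl⟩
        exact ⟨(a⁻¹ * a')⁻¹ * y, K.mul_mem (K.inv_mem haa) hy, by simp [mul_assoc]⟩
    -- A period $\chi$ takes the values $\eta$ and $\eta - T$, so $\chi^2 = (2\eta - T)\chi + T\eta
    -- - \eta^2$; this gives `r` and `t`. The case $b = 0$, where $\chi = |K| = \eta(T+1)$ and $T^2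
    -- = |F|$, gives `s`.
    rw [heq, if_pos haa, diffCount_eq_of_charSum hprim (r := T * η - η ^ 2) (s := η ^ 2 + η)
      (t := 2 * η - T) (t' := 0) ?_ hd]
    · ring
    intro b
    rw [hsumneg]
    by_cases hb : b = 0
    · subst hb
      rw [hsum0, if_pos rfl, ← hT]
      ring
    · rw [hsum a b hb, if_neg hb]
      split_ifs <;> ring
  -- For distinct cosets the drops by $T$ never coincide, so $(\chi - \eta)(\chi' - \eta) = 0$ for
  -- $b \ne 0$; $b = 0$ again fixes `s`.
  · rw [if_neg haa, diffCount_eq_of_charSum hprim (r := -η ^ 2) (s := η ^ 2)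
      (t := η) (t' := η) ?_ hd]
    · ring
    intro b
    rw [hsumneg]
    by_cases hb : b = 0
    · subst hb
      rw [hsum0, hsum0, if_pos rfl, ← hT]
      ring
    · rw [hsum a b hb, hsum a' b hb, if_neg hb]
      split_ifs with h1 h2
      · exact absurd (by
          have := K.mul_mem (K.inv_mem h1) h2
          convert this using 1
          simp [mul_assoc]) haa
      all_goals ring

end Cosets

/-! ### Cyclotomic classes -/

section CyclotomicClasses

variable {q β e : ℕ}

theorem dvd_card_sub_one {F : Type*} [Fintype F] (hF : Fintype.card F = q ^ (2 * β)) (hdvd : e ∣ q + 1) :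
    e ∣ Fintype.card F - 1 := by
  rw [hF]
  exact hdvd.trans ((Dvd.intro _ rfl).trans (succ_mul_pred_dvd_pow_sub_one q β))

theorem zpowers_pow_eq_range {F : Type*} [Field F] {α : Fˣ} (hα : ∀ x : Fˣ, x ∈ Subgroup.zpowers α) :
    Subgroup.zpowers (α ^ e) = (powMonoidHom e : Fˣ →* Fˣ).range := by
  rw [MonoidHom.range_eq_map, ← (Subgroup.eq_top_iff' _).2 hα, MonoidHom.map_zpowers]
  rfl

variable {F : Type*} [Field F] [Fintype F] {α : Fˣ}

theorem index_zpowers_pow (hα : ∀ x : Fˣ, x ∈ Subgroup.zpowers α)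
    (he : e ∣ Fintype.card F - 1) : (Subgroup.zpowers (α ^ e)).index = e := by
  classical
  rw [zpowers_pow_eq_range hα, IsCyclic.index_powMonoidHom_range, Nat.card_eq_fintype_card,
    Fintype.card_units, Nat.gcd_eq_right he]

/-- Since $e$ divides the order of $\alpha$, exponents are well defined modulo $e$. -/
theorem inv_pow_mul_pow_mem_iff (hα : ∀ x : Fˣ, x ∈ Subgroup.zpowers α)
    (he : e ∣ Fintype.card F - 1) {i j : ℕ} (hi : i < e) (hj : j < e) :
    (α ^ i)⁻¹ * α ^ j ∈ Subgroup.zpowers (α ^ e) ↔ i = j := by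
  classical
  refine ⟨fun h => ?_, fun h => by subst h; simp [one_mem]⟩
  obtain ⟨t, ht⟩ := mem_powers_iff_mem_zpowers.2 h
  simp only at ht
  have h1 : α ^ (i + e * t) = α ^ j := by
    rw [pow_add, pow_mul, ht, mul_inv_cancel_left]
  rw [pow_eq_pow_iff_modEq, orderOf_eq_card_of_forall_mem_zpowers hα,
    Nat.card_eq_fintype_card, Fintype.card_units] at h1
  have h2 := h1.of_dvd he
  unfold Nat.ModEq at h2
  rwa [Nat.add_mul_mod_self_left, Nat.mod_eq_of_lt hi, Nat.mod_eq_of_lt hj] at h2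

/-- $-1$ is fixed by $x \mapsto x^q$, hence a $(q+1)$-th power, hence an $e$-th power. This makes
the classes symmetric. -/
theorem neg_one_mem_zpowers_pow (hq : IsPrimePow q) (hF : Fintype.card F = q ^ (2 * β))
    (hdvd : e ∣ q + 1) (hα : ∀ x : Fˣ, x ∈ Subgroup.zpowers α) :
    -1 ∈ Subgroup.zpowers (α ^ e) := by
  classical
  obtain ⟨p, n, hp, hchar, hpq⟩ := exists_charP_of_card_eq_pow hq hF
  have h : (-1 : Fˣ) ^ q = -1 := by
    refine Units.ext ?_
    push_cast
    rw [hpq, neg_pow_charP_pow hp, one_pow]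
  obtain ⟨y, hy⟩ := mem_range_powMonoidHom_of_pow_eq hq.two_le hF h
  obtain ⟨m, hm⟩ := hdvd
  rw [zpowers_pow_eq_range hα]
  refine ⟨y ^ m, ?_⟩
  rw [← hy, powMonoidHom_apply, powMonoidHom_apply, hm, mul_comm e, pow_mul]

theorem card_mul_zpowers_pow (hF : Fintype.card F = q ^ (2 * β)) (hdvd : e ∣ q + 1)
    (hα : ∀ x : Fˣ, x ∈ Subgroup.zpowers α) :
    Nat.card (Subgroup.zpowers (α ^ e)) * e + 1 = q ^ (2 * β) := by
  classical
  have h1 := (Subgroup.zpowers (α ^ e)).card_mul_index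
  have := Fintype.card_pos (α := F)
  rw [index_zpowers_pow hα (dvd_card_sub_one hF hdvd), Nat.card_eq_fintype_card (α := Fˣ),
    Fintype.card_units] at h1
  rw [h1, ← hF]
  omega

/-- Difference counts of cyclotomic classes in the semiprimitive case. -/
theorem diffCount_cyclotomicClass [DecidableEq F] (hq : IsPrimePow q)
    (hF : Fintype.card F = q ^ (2 * β)) (he : e ≠ 0) (hdvd : e ∣ q + 1)
    (hα : ∀ x : Fˣ, x ∈ Subgroup.zpowers α) {η : ℚ} (hη : η = ((-(q : ℚ)) ^ β - 1) / e)
    {i j : ℕ} (hi : i < e) (hj : j < e) {d : F} (hd : d ≠ 0) :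
    (diffCount (cyclotomicClass α e i) (cyclotomicClass α e j) d : ℚ) = η ^ 2 +
      η * ((if d ∈ cyclotomicClass α e i then 1 else 0) +
        if d ∈ cyclotomicClass α e j then 1 else 0) +
      if i = j then η - (1 + e * η) * (if d ∈ cyclotomicClass α e i then 1 else 0) else 0 := by
  classical
  obtain ⟨p, n, hp, hchar, hpq⟩ := exists_charP_of_card_eq_pow hq hF
  obtain ⟨ψ, hprim, hψ⟩ := exists_isPrimitive_frobenius_invariant F p hp
  have hdvd' := dvd_card_sub_one hF hdvd
  have hle : (powMonoidHom (q + 1) : Fˣ →* Fˣ).range ≤ Subgroup.zpowers (α ^ e) := by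
    rw [zpowers_pow_eq_range hα]
    rintro _ ⟨y, rfl⟩
    obtain ⟨m, hm⟩ := hdvd
    refine ⟨y ^ m, ?_⟩
    rw [powMonoidHom_apply, powMonoidHom_apply, hm, mul_comm e, pow_mul]
  obtain ⟨c, hc⟩ := exists_gaussPeriod_eq hp hpq hq.two_le hF hprim hψ _ hle
    (index_zpowers_pow hα hdvd')
  have he0 : (e : ℂ) ≠ 0 := by exact_mod_cast he
  have hηC : (η : ℂ) = ((-(q : ℂ)) ^ β - 1) / e := by rw [hη]; push_cast; rfl
  have hT : (-(q : ℂ)) ^ β = 1 + e * η := by rw [hηC]; field_simp; ring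
  have hTsq : (1 + e * (η : ℂ)) ^ 2 = q ^ (2 * β) := by
    rw [← hT, ← pow_mul, mul_comm β 2, pow_mul, neg_sq, ← pow_mul]
  have hcard : (Nat.card (Subgroup.zpowers (α ^ e)) : ℂ) = η * ((1 + e * η) + 1) := by
    have h1 : (Nat.card (Subgroup.zpowers (α ^ e)) : ℂ) * e + 1 = q ^ (2 * β) := by
      exact_mod_cast card_mul_zpowers_pow hF hdvd hα
    apply mul_right_cancel₀ he0
    -- $e|K| = T^2 - 1 = (T-1)(T+1) = e\eta(T+1)$.
    linear_combination h1 - hTsq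
  have h := diffCount_unitCoset hprim (neg_one_mem_zpowers_pow hq hF hdvd hα)
    (c := c) (η := η) (T := 1 + e * η) (by rw [hTsq, hF]; push_cast; rfl) hcard
    (fun b => by rw [hc b, ← hT, hηC]) (α ^ i) (α ^ j) hd
  simp only [inv_pow_mul_pow_mem_iff hα hdvd' hi hj, ← cyclotomicClass_eq_unitCoset] at h
  apply Rat.cast_injective (α := ℂ)
  push_cast
  rw [h]
  by_cases h1 : d ∈ cyclotomicClass α e i <;> by_cases h2 : d ∈ cyclotomicClass α e j <;>
    by_cases h3 : i = j <;> simp [h1, h2, h3]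

end CyclotomicClasses

/-! ### From multiplicities to two-level multisets -/

section Counting

theorem sum_ite_mem_eq_ite_mem_biUnion {G ι : Type*} [DecidableEq G] {I : Finset ι} {C : ι → Finset G}
    (hC : (I : Set ι).PairwiseDisjoint C) (d : G) :
    ∑ i ∈ I, (if d ∈ C i then (1 : ℚ) else 0) = if d ∈ I.biUnion C then 1 else 0 := by
  split_ifs with h
  · obtain ⟨i, hi, hd⟩ := mem_biUnion.1 h
    rw [sum_eq_single_of_mem i hi, if_pos hd]
    intro j hj hji
    exact if_neg fun hd' => Finset.disjoint_left.1 (hC hj hi hji) hd' hd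
  · exact sum_eq_zero fun i hi => if_neg fun hd => h (mem_biUnion.2 ⟨i, hi, hd⟩)

variable {G : Type*} [AddGroup G] [DecidableEq G]

theorem count_externalDiff (A B : Finset G) (d : G) :
    (externalDiff A B).count d = diffCount A B d := by
  rw [externalDiff, Multiset.count_map, diffCount, ← sum_product', ← card_filter]
  simp only [Finset.card, filter_val, eq_comm]

theorem count_internalDiff (A : Finset G) {d : G} (hd : d ≠ 0) :
    (internalDiff A).count d = diffCount A A d := by
  rw [internalDiff, Multiset.count_map, diffCount, ← sum_product', ← card_filter,
    ← filter_val, ← Finset.card]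
  congr 1
  ext ⟨x, y⟩
  simp only [mem_filter, mem_offDiag, mem_product]
  constructor
  · rintro ⟨⟨hx, hy, -⟩, h⟩
    exact ⟨⟨hx, hy⟩, h.symm⟩
  · rintro ⟨⟨hx, hy⟩, h⟩
    exact ⟨⟨hx, hy, fun hxy => hd (by rw [← h, hxy, sub_self])⟩, h.symm⟩

theorem count_zero_internalDiff (A : Finset G) : (internalDiff A).count 0 = 0 := by
  rw [Multiset.count_eq_zero, internalDiff, Multiset.mem_map]
  rintro ⟨⟨x, y⟩, hxy, h⟩
  exact (mem_offDiag.1 hxy).2.2 (sub_eq_zero.1 h)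

theorem count_zero_externalDiff {A B : Finset G} (h : Disjoint A B) :
    (externalDiff A B).count 0 = 0 := by
  rw [Multiset.count_eq_zero, externalDiff, Multiset.mem_map]
  rintro ⟨⟨x, y⟩, hxy, h'⟩
  obtain ⟨hx, hy⟩ := mem_product.1 hxy
  exact Finset.disjoint_left.1 h hx (sub_eq_zero.1 h' ▸ hy)

theorem diffCount_biUnion {ι : Type*} {I : Finset ι} {C : ι → Finset G}
    (hC : (I : Set ι).PairwiseDisjoint C) (d : G) :
    diffCount (I.biUnion C) (I.biUnion C) d = ∑ i ∈ I, ∑ j ∈ I, diffCount (C i) (C j) d := by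
  unfold diffCount
  rw [sum_biUnion hC]
  refine sum_congr rfl fun i _ => ?_
  rw [sum_comm' (t' := C i) (s' := fun _ => I) (by simp [and_comm])]
  exact sum_congr rfl fun x _ => sum_biUnion hC

variable [Fintype G]

/-- A multiset of nonzero elements with two rational frequencies, both attained, is a two-level
multiset. -/
theorem exists_eq_twoLevel {M : Multiset G} {S : Finset G} {l m : ℚ} (hM : M.count 0 = 0)
    (h0 : 0 ∉ S) (hS : S.Nonempty) (hS' : ∃ d, d ≠ 0 ∧ d ∉ S)
    (h : ∀ d ≠ 0, (M.count d : ℚ) = m + (l - m) * if d ∈ S then 1 else 0) :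
    ∃ lam mu : ℕ, (lam : ℚ) = l ∧ (mu : ℚ) = m ∧ M = twoLevel S lam mu := by
  obtain ⟨s, hs⟩ := hS
  obtain ⟨s', hs0', hs'⟩ := hS'
  have hl : (M.count s : ℚ) = l := by
    rw [h s fun hs0 => h0 (hs0 ▸ hs), if_pos hs]
    ring
  have hm : (M.count s' : ℚ) = m := by
    rw [h s' hs0', if_neg hs']
    ring
  -- The natural levels are the multiplicities at `s` and `s'`; this is why both levels must be
  -- attained.
  refine ⟨_, _, hl, hm, Multiset.ext.2 fun d => ?_⟩
  rw [twoLevel, Multiset.count_add, Multiset.count_nsmul, Multiset.count_nsmul,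
    Multiset.count_eq_of_nodup S.nodup, Multiset.count_eq_of_nodup (Finset.nodup _)]
  simp only [mem_val, mem_sdiff, mem_univ, mem_singleton, true_and]
  by_cases hd : d = 0
  · subst hd
    simp [h0, hM]
  · have hh := h d hd
    apply Nat.cast_injective (R := ℚ)
    push_cast
    rw [hl, hm, hh]
    by_cases hdS : d ∈ S <;> simp [hd, hdS]

end Counting

/-! ### Families and unions of cyclotomic classes -/

section CyclotomicFamilies

variable {F : Type*} [Field F] [Fintype F] {q β e : ℕ} {α : Fˣ}

theorem pow_mem_cyclotomicClass (i : ℕ) : ((α ^ i : Fˣ) : F) ∈ cyclotomicClass α e i :=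
  mem_unitCoset.2 ⟨1, one_mem _, by simp⟩

theorem cyclotomicClass_disjoint (hα : ∀ x : Fˣ, x ∈ Subgroup.zpowers α)
    (he : e ∣ Fintype.card F - 1) {i j : ℕ} (hi : i < e) (hj : j < e) (hij : i ≠ j) :
    Disjoint (cyclotomicClass α e i) (cyclotomicClass α e j) :=
  unitCoset_disjoint ((inv_pow_mul_pow_mem_iff hα he hi hj).not.2 hij)

theorem cyclotomicClass_injOn (hα : ∀ x : Fˣ, x ∈ Subgroup.zpowers α)
    (he : e ∣ Fintype.card F - 1) {I : Finset ℕ} (hI : I ⊆ range e) :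
    Set.InjOn (cyclotomicClass α e) (I : Set ℕ) := by
  intro i hi j hj h
  by_contra hij
  have := cyclotomicClass_disjoint hα he (mem_range.1 (hI hi)) (mem_range.1 (hI hj)) hij
  rw [h, disjoint_self] at this
  exact notMem_empty _ (this ▸ pow_mem_cyclotomicClass (α := α) (e := e) j)

theorem cyclotomicClass_pairwiseDisjoint (hα : ∀ x : Fˣ, x ∈ Subgroup.zpowers α)
    (he : e ∣ Fintype.card F - 1) {I : Finset ℕ} (hI : I ⊆ range e) :
    (I : Set ℕ).PairwiseDisjoint (cyclotomicClass α e) := fun _ hi _ hj hij =>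
  cyclotomicClass_disjoint hα he (mem_range.1 (hI hi)) (mem_range.1 (hI hj)) hij

variable [DecidableEq F]

theorem cyclotomicClass_isDisjointFamily (hF : Fintype.card F = q ^ (2 * β)) (hdvd : e ∣ q + 1)
    (hα : ∀ x : Fˣ, x ∈ Subgroup.zpowers α) {I : Finset ℕ} (hI : I ⊆ range e) :
    IsDisjointFamily (I.image (cyclotomicClass α e)) (q ^ (2 * β)) I.card
      (Nat.card (Subgroup.zpowers (α ^ e))) where
  card_group := hF
  card_family := card_image_of_injOn (cyclotomicClass_injOn hα (dvd_card_sub_one hF hdvd) hI)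
  card_set := by
    intro D hD
    obtain ⟨i, -, rfl⟩ := mem_image.1 hD
    exact card_unitCoset _ _
  zero_notMem := by
    intro D hD
    obtain ⟨i, -, rfl⟩ := mem_image.1 hD
    exact zero_notMem_unitCoset _ _
  disjoint := by
    intro D hD D' hD' hne
    obtain ⟨i, hi, rfl⟩ := mem_image.1 hD
    obtain ⟨j, hj, rfl⟩ := mem_image.1 hD'
    exact cyclotomicClass_disjoint hα (dvd_card_sub_one hF hdvd) (mem_range.1 (hI hi))
      (mem_range.1 (hI hj)) fun h => hne (by rw [h])

/-- Sums of difference counts over a set of cyclotomic classes: the diagonal terms. -/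
theorem sum_diffCount_self (hq : IsPrimePow q) (hF : Fintype.card F = q ^ (2 * β)) (he : e ≠ 0)
    (hdvd : e ∣ q + 1) (hα : ∀ x : Fˣ, x ∈ Subgroup.zpowers α) {η : ℚ}
    (hη : η = ((-(q : ℚ)) ^ β - 1) / e) {I : Finset ℕ} (hI : I ⊆ range e) {d : F} (hd : d ≠ 0) :
    ∑ i ∈ I, (diffCount (cyclotomicClass α e i) (cyclotomicClass α e i) d : ℚ) =
      I.card * (η ^ 2 + η) +
        (2 * η - (1 + e * η)) * if d ∈ I.biUnion (cyclotomicClass α e) then 1 else 0 := by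
  rw [← sum_ite_mem_eq_ite_mem_biUnion
    (cyclotomicClass_pairwiseDisjoint hα (dvd_card_sub_one hF hdvd) hI), mul_sum,
    ← nsmul_eq_mul, ← sum_const, ← sum_add_distrib]
  refine sum_congr rfl fun i hi => ?_
  have hi' := mem_range.1 (hI hi)
  rw [diffCount_cyclotomicClass hq hF he hdvd hα hη hi' hi' hd, if_pos rfl]
  ring

/-- Sums of difference counts over a set of cyclotomic classes: all terms. -/
theorem sum_sum_diffCount (hq : IsPrimePow q) (hF : Fintype.card F = q ^ (2 * β)) (he : e ≠ 0)
    (hdvd : e ∣ q + 1) (hα : ∀ x : Fˣ, x ∈ Subgroup.zpowers α) {η : ℚ}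
    (hη : η = ((-(q : ℚ)) ^ β - 1) / e) {I : Finset ℕ} (hI : I ⊆ range e) {d : F} (hd : d ≠ 0) :
    ∑ i ∈ I, ∑ j ∈ I, (diffCount (cyclotomicClass α e i) (cyclotomicClass α e j) d : ℚ) =
      I.card ^ 2 * η ^ 2 + I.card * η +
        (2 * I.card * η - (1 + e * η)) *
          if d ∈ I.biUnion (cyclotomicClass α e) then 1 else 0 := by
  have hsum := sum_ite_mem_eq_ite_mem_biUnion
    (cyclotomicClass_pairwiseDisjoint hα (dvd_card_sub_one hF hdvd) hI) d
  have h1 : ∀ i ∈ I, ∑ j ∈ I,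
      (diffCount (cyclotomicClass α e i) (cyclotomicClass α e j) d : ℚ) =
        (I.card * η ^ 2 + η +
          η * if d ∈ I.biUnion (cyclotomicClass α e) then 1 else 0) +
        (I.card * η - (1 + e * η)) * if d ∈ cyclotomicClass α e i then 1 else 0 := by
    intro i hi
    rw [sum_congr rfl fun j hj => diffCount_cyclotomicClass hq hF he hdvd hα hη
      (mem_range.1 (hI hi)) (mem_range.1 (hI hj)) hd]
    simp only [sum_add_distrib, ← mul_sum, hsum, sum_const, nsmul_eq_mul, sum_ite_eq, hi, if_true]
    ring
  rw [sum_congr rfl h1, sum_add_distrib, sum_const, ← mul_sum, hsum, nsmul_eq_mul]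
  ring

/-- A union of fewer than `e` classes misses a nonzero element. -/
theorem exists_notMem_biUnion_cyclotomicClass (hα : ∀ x : Fˣ, x ∈ Subgroup.zpowers α)
    (he : e ∣ Fintype.card F - 1) {I : Finset ℕ} (hI : I ⊆ range e) (hcard : I.card < e) :
    ∃ d : F, d ≠ 0 ∧ d ∉ I.biUnion (cyclotomicClass α e) := by
  obtain ⟨j, hj, hjI⟩ := exists_mem_notMem_of_card_lt_card (s := I) (t := range e) (by simpa)
  refine ⟨((α ^ j : Fˣ) : F), Units.ne_zero _, fun h => ?_⟩
  obtain ⟨i, hi, hmem⟩ := mem_biUnion.1 h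
  exact Finset.disjoint_left.1 (cyclotomicClass_disjoint hα he (mem_range.1 (hI hi))
    (mem_range.1 hj) fun hij => hjI (hij ▸ hi)) hmem (pow_mem_cyclotomicClass j)

theorem biUnion_cyclotomicClass_nonempty {I : Finset ℕ} (hI : I.Nonempty) :
    (I.biUnion (cyclotomicClass α e)).Nonempty := by
  obtain ⟨i, hi⟩ := hI
  exact ⟨_, mem_biUnion.2 ⟨i, hi, pow_mem_cyclotomicClass i⟩⟩

theorem zero_notMem_biUnion_cyclotomicClass (I : Finset ℕ) :
    (0 : F) ∉ I.biUnion (cyclotomicClass α e) := by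
  rw [mem_biUnion]
  rintro ⟨i, -, hi⟩
  exact zero_notMem_unitCoset _ _ hi

/-- Unions of cyclotomic classes are regular partial difference sets. -/
theorem biUnion_cyclotomicClass_isRegularPDS (hq : IsPrimePow q)
    (hF : Fintype.card F = q ^ (2 * β)) (he : e ≠ 0) (hdvd : e ∣ q + 1)
    (hα : ∀ x : Fˣ, x ∈ Subgroup.zpowers α) {η : ℚ} (hη : η = ((-(q : ℚ)) ^ β - 1) / e)
    {I : Finset ℕ} (hI : I ⊆ range e) (hne : I.Nonempty) (hcard : I.card < e) :
    ∃ lam mu : ℕ,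
      (lam : ℚ) = I.card ^ 2 * η ^ 2 + (3 * I.card - e) * η - 1 ∧
      (mu : ℚ) = I.card ^ 2 * η ^ 2 + I.card * η ∧
      IsRegularPDS (I.biUnion (cyclotomicClass α e)) (q ^ (2 * β))
        (I.card * Nat.card (Subgroup.zpowers (α ^ e))) lam mu := by
  have hdisj := cyclotomicClass_pairwiseDisjoint hα (dvd_card_sub_one hF hdvd) hI
  obtain ⟨lam, mu, hl, hm, h⟩ := exists_eq_twoLevel
    (M := internalDiff (I.biUnion (cyclotomicClass α e)))
    (l := I.card ^ 2 * η ^ 2 + (3 * I.card - e) * η - 1)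
    (m := I.card ^ 2 * η ^ 2 + I.card * η)
    (count_zero_internalDiff _) (zero_notMem_biUnion_cyclotomicClass I)
    (biUnion_cyclotomicClass_nonempty hne)
    (exists_notMem_biUnion_cyclotomicClass hα (dvd_card_sub_one hF hdvd) hI hcard) (by
      intro d hd
      rw [count_internalDiff _ hd, diffCount_biUnion hdisj]
      push_cast
      rw [sum_sum_diffCount hq hF he hdvd hα hη hI hd]
      ring)
  refine ⟨lam, mu, hl, hm, ⟨hF, ?_, h⟩, ?_, zero_notMem_biUnion_cyclotomicClass I⟩
  · rw [card_biUnion hdisj]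
    exact sum_const_nat fun i _ => card_unitCoset _ _
  · rw [biUnion_image]
    exact biUnion_congr rfl fun i _ =>
      image_neg_unitCoset (neg_one_mem_zpowers_pow hq hF hdvd hα) _

/-- Families of cyclotomic classes are disjoint partial difference families. -/
theorem image_cyclotomicClass_isDPDF (hq : IsPrimePow q)
    (hF : Fintype.card F = q ^ (2 * β)) (he : e ≠ 0) (hdvd : e ∣ q + 1)
    (hα : ∀ x : Fˣ, x ∈ Subgroup.zpowers α) {η : ℚ} (hη : η = ((-(q : ℚ)) ^ β - 1) / e)
    {I : Finset ℕ} (hI : I ⊆ range e) (hne : I.Nonempty) (hcard : I.card < e) :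
    ∃ lam mu : ℕ,
      (lam : ℚ) = I.card * η ^ 2 + (I.card + 2 - e) * η - 1 ∧
      (mu : ℚ) = I.card * (η ^ 2 + η) ∧
      IsDPDF (I.image (cyclotomicClass α e)) (q ^ (2 * β)) I.card
        (Nat.card (Subgroup.zpowers (α ^ e))) lam mu := by
  have hinj := cyclotomicClass_injOn hα (dvd_card_sub_one hF hdvd) hI
  obtain ⟨lam, mu, hl, hm, h⟩ := exists_eq_twoLevel
    (M := ∑ D ∈ I.image (cyclotomicClass α e), internalDiff D)
    (l := I.card * η ^ 2 + (I.card + 2 - e) * η - 1)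
    (m := I.card * (η ^ 2 + η))
    (by
      rw [Multiset.count_sum']
      exact sum_eq_zero fun D _ => count_zero_internalDiff D)
    (zero_notMem_biUnion_cyclotomicClass I) (biUnion_cyclotomicClass_nonempty hne)
    (exists_notMem_biUnion_cyclotomicClass hα (dvd_card_sub_one hF hdvd) hI hcard) (by
      intro d hd
      rw [Multiset.count_sum', sum_image hinj,
        sum_congr rfl fun i _ => count_internalDiff (cyclotomicClass α e i) hd]
      push_cast
      rw [sum_diffCount_self hq hF he hdvd hα hη hI hd]
      ring)
  refine ⟨lam, mu, hl, hm, cyclotomicClass_isDisjointFamily hF hdvd hα hI, ?_⟩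
  rw [h, image_biUnion]
  rfl

/-- Families of cyclotomic classes are external partial difference families. -/
theorem image_cyclotomicClass_isEPDF (hq : IsPrimePow q)
    (hF : Fintype.card F = q ^ (2 * β)) (he : e ≠ 0) (hdvd : e ∣ q + 1)
    (hα : ∀ x : Fˣ, x ∈ Subgroup.zpowers α) {η : ℚ} (hη : η = ((-(q : ℚ)) ^ β - 1) / e)
    {I : Finset ℕ} (hI : I ⊆ range e) (hne : I.Nonempty) (hcard : I.card < e) :
    ∃ lam mu : ℕ,
      (lam : ℚ) = I.card * (I.card - 1) * η ^ 2 + 2 * (I.card - 1) * η ∧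
      (mu : ℚ) = I.card * (I.card - 1) * η ^ 2 ∧
      IsEPDF (I.image (cyclotomicClass α e)) (q ^ (2 * β)) I.card
        (Nat.card (Subgroup.zpowers (α ^ e))) lam mu := by
  have hinj := cyclotomicClass_injOn hα (dvd_card_sub_one hF hdvd) hI
  have hfam := cyclotomicClass_isDisjointFamily hF hdvd hα hI
  obtain ⟨lam, mu, hl, hm, h⟩ := exists_eq_twoLevel
    (M := ∑ p ∈ (I.image (cyclotomicClass α e)).offDiag, externalDiff p.1 p.2)
    (l := I.card * (I.card - 1) * η ^ 2 + 2 * (I.card - 1) * η)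
    (m := I.card * (I.card - 1) * η ^ 2)
    (by
      rw [Multiset.count_sum']
      refine sum_eq_zero fun p hp => ?_
      obtain ⟨h1, h2, h3⟩ := mem_offDiag.1 hp
      exact count_zero_externalDiff (hfam.disjoint _ h1 _ h2 h3))
    (zero_notMem_biUnion_cyclotomicClass I) (biUnion_cyclotomicClass_nonempty hne)
    (exists_notMem_biUnion_cyclotomicClass hα (dvd_card_sub_one hF hdvd) hI hcard) (by
      intro d hd
      rw [Multiset.count_sum', sum_congr rfl fun p _ => count_externalDiff p.1 p.2 d]
      -- External differences are all ordered pairs minus the diagonal, and both sums are known.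
      have h1 : ∑ p ∈ (I.image (cyclotomicClass α e)).diag, (diffCount p.1 p.2 d : ℚ) +
          ∑ p ∈ (I.image (cyclotomicClass α e)).offDiag, (diffCount p.1 p.2 d : ℚ) =
          ∑ i ∈ I, ∑ j ∈ I,
            (diffCount (cyclotomicClass α e i) (cyclotomicClass α e j) d : ℚ) := by
        rw [← sum_union (disjoint_diag_offDiag _), diag_union_offDiag, sum_product,
          sum_image hinj]
        exact sum_congr rfl fun i _ => sum_image hinj
      rw [sum_diag, sum_image hinj, sum_diffCount_self hq hF he hdvd hα hη hI hd,
        sum_sum_diffCount hq hF he hdvd hα hη hI hd] at h1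
      push_cast
      linear_combination h1)
  refine ⟨lam, mu, hl, hm, hfam, ?_⟩
  rw [h, image_biUnion]
  rfl

end CyclotomicFamilies

/-- $e \mid q+1 \mid (-q)^\beta - 1$. Integrality of $\eta$ decides when the union is proper. -/
theorem exists_intCast_eq_of_dvd {q β e : ℕ} (he : e ≠ 0) (hdvd : e ∣ q + 1) :
    ∃ z : ℤ, (z : ℚ) = ((-(q : ℚ)) ^ β - 1) / e := by
  have h1 : (e : ℤ) ∣ (-(q : ℤ)) ^ β - 1 := by
    have h2 := sub_dvd_pow_sub_pow (-(q : ℤ)) 1 β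
    rw [one_pow] at h2
    refine Dvd.dvd.trans ?_ h2
    have h3 : -(q : ℤ) - 1 = -((q + 1 : ℕ) : ℤ) := by push_cast; ring
    rw [h3, dvd_neg]
    exact Int.natCast_dvd_natCast.2 hdvd
  obtain ⟨z, hz⟩ := h1
  refine ⟨z, ?_⟩
  have he' : (e : ℚ) ≠ 0 := by exact_mod_cast he
  rw [eq_div_iff he']
  have : ((-(q : ℚ)) ^ β - 1) = e * z := by exact_mod_cast hz
  rw [this, mul_comm]

end SemiprimitiveCyclotomy

/-- `F` is the field of order `q' = q ^ (2 * β)`, `α` a primitive element of `F`, `e ≥ 3` divides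
`q + 1`, and `η = ((-q) ^ β - 1) / e` (computed in `ℚ`). The natural numbers `k`, `lam`, `mu` are
the parameters of the structures; their values are given in `ℚ`. -/
theorem mainTheorem1 {F : Type*} [Field F] [Fintype F] [DecidableEq F]
    (q β e : ℕ) (hq : IsPrimePow q) (hF : Fintype.card F = q ^ (2 * β))
    (he : 3 ≤ e) (hdvd : e ∣ q + 1)
    (α : Fˣ) (hα : ∀ x : Fˣ, x ∈ Subgroup.zpowers α)
    (η : ℚ) (hη : η = ((-(q : ℚ)) ^ β - 1) / e) :
    ∃ k : ℕ, (k : ℚ) = ((q : ℚ) ^ (2 * β) - 1) / e ∧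
      (∀ i < e, ∃ lam mu : ℕ,
        (lam : ℚ) = η ^ 2 - (e - 3) * η - 1 ∧
        (mu : ℚ) = η ^ 2 + η ∧
        IsRegularPDS (cyclotomicClass α e i) (q ^ (2 * β)) k lam mu) ∧
      (∀ (I : Finset ℕ) (u : ℕ), I ⊆ Finset.range e → I.card = u → 2 ≤ u → u ≤ e - 1 →
        (∃ lam mu : ℕ,
          (lam : ℚ) = u * η ^ 2 + (u + 2 - e) * η - 1 ∧
          (mu : ℚ) = u * (η ^ 2 + η) ∧
          IsDPDF (I.image (cyclotomicClass α e)) (q ^ (2 * β)) u k lam mu) ∧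
        (∃ lam mu : ℕ,
          (lam : ℚ) = u * (u - 1) * η ^ 2 + 2 * (u - 1) * η ∧
          (mu : ℚ) = u * (u - 1) * η ^ 2 ∧
          IsEPDF (I.image (cyclotomicClass α e)) (q ^ (2 * β)) u k lam mu) ∧
        (∃ lam mu : ℕ,
          (lam : ℚ) = u ^ 2 * η ^ 2 + (3 * u - e) * η - 1 ∧
          (mu : ℚ) = u ^ 2 * η ^ 2 + u * η ∧
          IsRegularPDS (I.biUnion (cyclotomicClass α e)) (q ^ (2 * β)) (u * k) lam mu ∧
          (IsProperPDS (I.biUnion (cyclotomicClass α e)) (q ^ (2 * β)) (u * k) lam mu ↔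
            ¬ ((η = 1 ∧ 2 * (u : ℚ) - e = 1) ∨ (η = -1 ∧ 2 * (u : ℚ) - e = -1))))) := by
  have he0 : e ≠ 0 := by omega
  have he' : (e : ℚ) ≠ 0 := by exact_mod_cast he0
  refine ⟨Nat.card (Subgroup.zpowers (α ^ e)), ?_, ?_, ?_⟩
  · rw [eq_div_iff he', eq_sub_iff_add_eq]
    exact_mod_cast card_mul_zpowers_pow hF hdvd hα
  · intro i hi
    -- Part (i) is the case $u = 1$ of the union statement.
    obtain ⟨lam, mu, hl, hm, h⟩ := biUnion_cyclotomicClass_isRegularPDS hq hF he0 hdvd hα hη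
      (I := {i}) (by simpa using hi) (Finset.singleton_nonempty i)
      (by rw [Finset.card_singleton]; omega)
    rw [Finset.singleton_biUnion, Finset.card_singleton, one_mul] at h
    rw [Finset.card_singleton] at hl hm
    push_cast at hl hm
    exact ⟨lam, mu, by rw [hl]; ring, by rw [hm]; ring, h⟩
  · rintro I u hI rfl hu hu'
    have hne : I.Nonempty := Finset.card_pos.1 (by omega)
    have hlt : I.card < e := by omega
    refine ⟨image_cyclotomicClass_isDPDF hq hF he0 hdvd hα hη hI hne hlt,
      image_cyclotomicClass_isEPDF hq hF he0 hdvd hα hη hI hne hlt, ?_⟩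
    obtain ⟨lam, mu, hl, hm, h⟩ :=
      biUnion_cyclotomicClass_isRegularPDS hq hF he0 hdvd hα hη hI hne hlt
    refine ⟨lam, mu, hl, hm, h, ?_⟩
    have hiff : lam = mu ↔
        (η = 1 ∧ 2 * (I.card : ℚ) - e = 1) ∨ (η = -1 ∧ 2 * (I.card : ℚ) - e = -1) := by
      obtain ⟨z, hz⟩ := exists_intCast_eq_of_dvd (β := β) he0 hdvd
      rw [← hη] at hz
      -- $\lambda - \mu = (2u - e)\eta - 1$, and a product of two integers is $1$ only if both are
      -- $1$ or both are $-1$.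
      have h1 : lam = mu ↔ z * (2 * I.card - e) = 1 := by
        rw [← Nat.cast_inj (R := ℚ), hl, hm, ← Int.cast_inj (α := ℚ)]
        push_cast
        rw [hz]
        constructor <;> intro h <;> linear_combination h
      rw [h1, Int.mul_eq_one_iff_eq_one_or_neg_one, ← hz]
      norm_cast
    rw [← hiff]
    exact ⟨fun hp => hp.proper, fun hp => ⟨h.toIsPDS, hp⟩⟩
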